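/- Notation. Let $\mathbb{D}=\{\zeta\in\mathbb{C}:|\zeta|<1\}$ and let $\rho(\zeta,\eta)=\tanh^{-1}\left|\frac{\zeta-\eta}{1-\overline{\eta}\zeta}\right|$ be the Poincaré distance on $\mathbb{D}$. For an embedded complex submanifold $M$ of $\mathbb{C}^d$, the Kobayashi pseudodistance $\mathsf{k}_M(z,w)$ of $z,w\in M$ is the infimum of $\sum_{i=1}^m\rho(\zeta_i,\eta_i)$ over all $m\geq 1$, all $\zeta_i,\eta_i\in\mathbb{D}$ and all holomorphic maps $f_1,\dots,f_m:\mathbb{D}\to M$ with $f_1(\zeta_1)=z$, $f_i(\eta_i)=f_{i+1}(\zeta_{i+1})$ for $1\leq i<m$, and $f_m(\eta_m)=w$. The Kobayashi pseudometric is $$\kappa_M(z,X)=\inf\{\alpha>0:\ \text{there is a holomorphic } f:\mathbb{D}\to M \text{ with } f(0)=z \text{ and } \alpha f'(0)=X\}$$ for $z\in M$ and $X$ tangent to $M$ at $z$. For $\lambda\geq 1$ and $\kappa\geq 0$, a curve $\sigma:[a,b]\to M$ is a $(\lambda,\kappa)$-almost-geodesic if 1. for all $s,t\in[a,b]$, $\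 \frac{1}{\lambda}|t-s|-\kappa\leq\mathsf{k}_M(\sigma(t),\sigma(s))\leq\lambda|t-s|+\kappa$; and 2. $\sigma$ is absolutely continuous (as a map into $\mathbb{C}^d$), so that $\sigma'(t)$ exists for almost every $t\in[a,b]$, and $\kappa_M(\sigma(t),\sigma'(t))\leq\lambda$ for almost every $t\in[a,b]$. Theorem. Let $M$ be a bounded, connected, embedded complex submanifold of $\mathbb{C}^d$. For all $z,w\in M$ and every $\kappa>0$ there exist real numbers $a<b$ and a $(1,\kappa)$-almost-geodesic $\sigma:[a,b]\to M$ such that $\sigma(a)=z$ and $\sigma(b)=w$. -/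

import Mathlib

open Set Metric MeasureTheory
open scoped ENNReal NNReal ComplexConjugate

noncomputable section

/-- The complex Euclidean space `ℂ^d` with its Euclidean norm. -/
abbrev CSpace (d : ℕ) : Type := EuclideanSpace ℂ (Fin d)

/-- `M ⊆ ℂ^d` is an embedded complex submanifold of (complex) dimension `n`: every point of `M` has
a neighbourhood in `ℂ^d` (the source of `Φ`) that is mapped biholomorphically by `Φ` onto an open
subset of `ℂ^d`, in such a way that the part of `M` in it is carried onto a slice by an
`n`-dimensional complex linear subspace `V`. The set `M` need not be closed. -/
def IsEmbeddedComplexSubmanifold {d : ℕ} (n : ℕ) (M : Set (CSpace d)) : Prop :=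
  ∀ p ∈ M, ∃ (Φ : OpenPartialHomeomorph (CSpace d) (CSpace d)) (V : Submodule ℂ (CSpace d)),
    p ∈ Φ.source ∧
    DifferentiableOn ℂ Φ Φ.source ∧
    DifferentiableOn ℂ Φ.symm Φ.target ∧
    Module.finrank ℂ V = n ∧
    Φ '' (Φ.source ∩ M) = Φ.target ∩ (V : Set (CSpace d))

/-- `f` is a holomorphic map from the open unit disc to the submanifold `M` of `ℂ^d`
(only the values of `f` on the disc matter). A map into an embedded submanifold is holomorphic
exactly when it is holomorphic as a map into `ℂ^d`. -/
def IsHolomorphicDisc {d : ℕ} (M : Set (CSpace d)) (f : ℂ → CSpace d) : Prop :=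
  DifferentiableOn ℂ f (ball 0 1) ∧ MapsTo f (ball 0 1) M

/-- The Poincaré distance `artanh |(a - b) / (1 - b̄ a)|` of the points `a`, `b` of the unit disc;
it is induced by the metric `|dζ| / (1 - |ζ|²)`. -/
def poincareDist (a b : ℂ) : ℝ :=
  Real.artanh ‖(a - b) / (1 - conj b * a)‖

/-- The Kobayashi(–Royden) pseudometric
`κ_M(z, X) = inf {α > 0 : ∃ f : 𝔻 → M holomorphic, f(0) = z, α f'(0) = X}`
for `z ∈ M` and `X` a tangent vector of `M` at `z` (the infimum is `∞` if `X` is not tangent). -/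
def kobayashiMetric {d : ℕ} (M : Set (CSpace d)) (z X : CSpace d) : ℝ≥0∞ :=
  sInf {t : ℝ≥0∞ | ∃ α : ℝ≥0, 0 < α ∧ t = α ∧
    ∃ f : ℂ → CSpace d, IsHolomorphicDisc M f ∧ f 0 = z ∧ (α : ℝ) • deriv f 0 = X}

/-- A chain of `m ≥ 1` holomorphic discs in `M` from `z` to `w`: holomorphic maps `f i : 𝔻 → M` and
points `a i`, `b i` of the disc, for `i < m`, with `f i (a i) = p i` and `f i (b i) = p (i + 1)`,
where `p 0 = z` and `p m = w` (entries with larger indices play no role). -/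
structure DiscChain {d : ℕ} (M : Set (CSpace d)) (z w : CSpace d) where
  m : ℕ
  m_pos : 0 < m
  p : ℕ → CSpace d
  f : ℕ → ℂ → CSpace d
  a : ℕ → ℂ
  b : ℕ → ℂ
  p_zero : p 0 = z
  p_last : p m = w
  holo : ∀ i < m, IsHolomorphicDisc M (f i)
  a_mem : ∀ i < m, a i ∈ ball (0 : ℂ) 1
  b_mem : ∀ i < m, b i ∈ ball (0 : ℂ) 1
  f_a : ∀ i < m, f i (a i) = p i
  f_b : ∀ i < m, f i (b i) = p (i + 1)

/-- The total Poincaré length of a chain of discs. -/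
def DiscChain.length {d : ℕ} {M : Set (CSpace d)} {z w : CSpace d} (c : DiscChain M z w) : ℝ :=
  ∑ i ∈ Finset.range c.m, poincareDist (c.a i) (c.b i)

/-- The Kobayashi (pseudo)distance `k_M(z, w)`: the infimum of the total Poincaré lengths of chains
of holomorphic discs in `M` from `z` to `w` (`∞` if there is no chain). -/
def kobayashiDist {d : ℕ} (M : Set (CSpace d)) (z w : CSpace d) : ℝ≥0∞ :=
  ⨅ c : DiscChain M z w, ENNReal.ofReal c.length

/-- `σ : [a, b] → M` is a `(lam, κ)`-almost-geodesic (for `lam ≥ 1`, `κ ≥ 0`): it is absolutely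
continuous, it satisfies `|t - s| / lam - κ ≤ k_M(σ(t), σ(s)) ≤ lam |t - s| + κ` for all `s`, `t` in
`[a, b]`, and for almost every `t` in `[a, b]` the derivative `σ'(t)` exists and
`κ_M(σ(t), σ'(t)) ≤ lam`. Only the values of `σ` on `[a, b]` matter. -/
structure IsAlmostGeodesic {d : ℕ} (M : Set (CSpace d)) (lam κ : ℝ) (a b : ℝ)
    (σ : ℝ → CSpace d) : Prop where
  mapsTo : MapsTo σ (Icc a b) M
  lower : ∀ s ∈ Icc a b, ∀ t ∈ Icc a b,
    ENNReal.ofReal (1 / lam * |t - s| - κ) ≤ kobayashiDist M (σ t) (σ s)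
  upper : ∀ s ∈ Icc a b, ∀ t ∈ Icc a b,
    kobayashiDist M (σ t) (σ s) ≤ ENNReal.ofReal (lam * |t - s| + κ)
  absCont : AbsolutelyContinuousOnInterval σ a b
  speed : ∀ᵐ t ∂(volume.restrict (Icc a b)),
    DifferentiableAt ℝ σ t ∧ kobayashiMetric M (σ t) (deriv σ t) ≤ ENNReal.ofReal lam

end

/-!
A disc `f : 𝔻 → M` carries the hyperbolic segment from `a` to `b`, parametrized by Poincaré arc
length, to a curve of Kobayashi speed at most `1` which does not increase distances. Concatenating
along a chain of discs whose length exceeds `k_M(z, w)` by at most `κ` gives such a curve of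
duration `L ≤ k_M(z, w) + κ` from `z` to `w`. Only the lower estimate remains, and it holds because
the curve has little time to waste: for `s ≤ t`, going from `z` to `σ(s)` and from `σ(t)` to `w`
costs at most `L - (t - s)`, so `σ(s)` and `σ(t)` are at distance at least `t - s - κ`.
-/

open scoped Topology

section HyperbolicTangent

theorem abs_real_tanh (t : ℝ) : |Real.tanh t| = Real.tanh |t| := by
  rw [Real.tanh_eq_sinh_div_cosh, Real.tanh_eq_sinh_div_cosh, abs_div, Real.abs_sinh,
    Real.cosh_abs, abs_of_pos (Real.cosh_pos t)]

theorem real_tanh_sub (s t : ℝ) :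
    Real.tanh (s - t) = (Real.tanh s - Real.tanh t) / (1 - Real.tanh t * Real.tanh s) := by
  have hs := (Real.cosh_pos s).ne'
  have ht := (Real.cosh_pos t).ne'
  simp only [Real.tanh_eq_sinh_div_cosh]
  rw [Real.sinh_sub, Real.cosh_sub, ← div_div_div_cancel_right₀ (mul_ne_zero hs ht)]
  congr 1 <;> field_simp

theorem hasDerivAt_real_tanh (t : ℝ) : HasDerivAt Real.tanh (1 - Real.tanh t ^ 2) t := by
  have hc := (Real.cosh_pos t).ne'
  rw [funext Real.tanh_eq_sinh_div_cosh]
  exact ((Real.hasDerivAt_sinh t).fun_div (Real.hasDerivAt_cosh t) hc).congr_deriv (by field_simp)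

theorem contDiff_real_tanh {n : WithTop ℕ∞} : ContDiff ℝ n Real.tanh := by
  rw [funext Real.tanh_eq_sinh_div_cosh]
  exact Real.contDiff_sinh.div Real.contDiff_cosh fun x => (Real.cosh_pos x).ne'

theorem ofReal_tanh_mem_ball (t : ℝ) : (Real.tanh t : ℂ) ∈ ball (0 : ℂ) 1 := by
  rw [mem_ball_zero_iff, Complex.norm_real]
  exact Real.abs_tanh_lt_one t

end HyperbolicTangent

section Disc

variable {a b ζ : ℂ}

/-- The automorphism `ζ ↦ (a + ζ) / (1 + a̅ ζ)` of the unit disc (for `‖a‖ < 1`), which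
moves `0` to `a`; its inverse is `discShift (-a)`. -/
noncomputable def discShift (a ζ : ℂ) : ℂ := (a + ζ) / (1 + conj a * ζ)

theorem norm_add_lt_norm_one_add_conj_mul (ha : ‖a‖ < 1) (hζ : ‖ζ‖ < 1) :
    ‖a + ζ‖ < ‖1 + conj a * ζ‖ := by
  have difference_of_squares :
      ‖1 + conj a * ζ‖ ^ 2 - ‖a + ζ‖ ^ 2 = (1 - ‖a‖ ^ 2) * (1 - ‖ζ‖ ^ 2) := by
    simp only [← Complex.normSq_eq_norm_sq, Complex.normSq_apply, Complex.add_re, Complex.add_im,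
      Complex.mul_re, Complex.mul_im, Complex.conj_re, Complex.conj_im, Complex.one_re,
      Complex.one_im]
    ring
  have ha' : 0 < 1 - ‖a‖ ^ 2 := by nlinarith [norm_nonneg a]
  have hζ' : 0 < 1 - ‖ζ‖ ^ 2 := by nlinarith [norm_nonneg ζ]
  exact lt_of_pow_lt_pow_left₀ 2 (norm_nonneg _) (by nlinarith [mul_pos ha' hζ'])

theorem one_add_conj_mul_ne_zero (ha : a ∈ ball (0 : ℂ) 1) (hζ : ζ ∈ ball (0 : ℂ) 1) :
    1 + conj a * ζ ≠ 0 := by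
  rw [mem_ball_zero_iff] at ha hζ
  exact norm_pos_iff.1 ((norm_nonneg _).trans_lt (norm_add_lt_norm_one_add_conj_mul ha hζ))

theorem mapsTo_discShift (ha : a ∈ ball (0 : ℂ) 1) :
    MapsTo (discShift a) (ball 0 1) (ball 0 1) := by
  intro ζ hζ
  have hne := one_add_conj_mul_ne_zero ha hζ
  rw [mem_ball_zero_iff] at ha hζ ⊢
  rw [discShift, norm_div, div_lt_one (norm_pos_iff.2 hne)]
  exact norm_add_lt_norm_one_add_conj_mul ha hζ

theorem differentiableOn_discShift (ha : a ∈ ball (0 : ℂ) 1) :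
    DifferentiableOn ℂ (discShift a) (ball 0 1) :=
  DifferentiableOn.fun_div (by fun_prop) (by fun_prop) fun _ hζ => one_add_conj_mul_ne_zero ha hζ

theorem discShift_zero (a : ℂ) : discShift a 0 = a := by simp [discShift]

theorem hasDerivAt_discShift_zero (a : ℂ) :
    HasDerivAt (discShift a) ((1 - ‖a‖ ^ 2 : ℝ) : ℂ) 0 := by
  have hnum : HasDerivAt (fun ζ : ℂ => a + ζ) 1 0 := (hasDerivAt_id 0).const_add a
  have hden : HasDerivAt (fun ζ : ℂ => 1 + conj a * ζ) (conj a) 0 := by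
    simpa using ((hasDerivAt_id (0 : ℂ)).const_mul (conj a)).const_add 1
  exact (hnum.fun_div hden (by simp)).congr_deriv (by simp [Complex.mul_conj'])

theorem discShift_discShift_neg (ha : a ∈ ball (0 : ℂ) 1) (hb : b ∈ ball (0 : ℂ) 1) :
    discShift a (discShift (-a) b) = b := by
  have hna : -a ∈ ball (0 : ℂ) 1 := by simpa using ha
  have houter := one_add_conj_mul_ne_zero ha (mapsTo_discShift hna hb)
  have hinner : discShift (-a) b * (1 - conj a * b) = b - a := by
    have hne : 1 - conj a * b ≠ 0 := by
      simpa [sub_eq_add_neg] using one_add_conj_mul_ne_zero hna hb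
    rw [discShift, map_neg, neg_mul, ← sub_eq_add_neg, div_mul_cancel₀ _ hne, neg_add_eq_sub]
  rw [discShift, div_eq_iff houter]
  linear_combination hinner

theorem poincareDist_nonneg (a b : ℂ) : 0 ≤ poincareDist a b :=
  Real.artanh_nonneg (norm_nonneg _)

theorem poincareDist_comm (a b : ℂ) : poincareDist a b = poincareDist b a := by
  have hconj : conj (1 - conj b * a) = 1 - conj a * b := by simp [mul_comm]
  rw [poincareDist, poincareDist, norm_div, norm_div, norm_sub_rev, ← hconj, Complex.norm_conj]

theorem poincareDist_tanh (s t : ℝ) : poincareDist (Real.tanh s) (Real.tanh t) = |s - t| := by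
  have hquot : ((Real.tanh s : ℂ) - Real.tanh t) / (1 - conj (Real.tanh t : ℂ) * Real.tanh s) =
      (Real.tanh (s - t) : ℝ) := by
    rw [Complex.conj_ofReal, real_tanh_sub]
    push_cast
    rfl
  rw [poincareDist, hquot, Complex.norm_real, Real.norm_eq_abs, abs_real_tanh, Real.artanh_tanh]

theorem tanh_poincareDist (ha : a ∈ ball (0 : ℂ) 1) (hb : b ∈ ball (0 : ℂ) 1) :
    Real.tanh (poincareDist a b) = ‖discShift (-a) b‖ := by
  have hdist : poincareDist a b = Real.artanh ‖discShift (-a) b‖ := by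
    rw [poincareDist_comm, poincareDist, discShift]
    congr 2
    simp only [map_neg]
    ring
  have hlt : ‖discShift (-a) b‖ < 1 :=
    mem_ball_zero_iff.1 (mapsTo_discShift (by simpa using ha) hb)
  rw [hdist, Real.tanh_artanh ⟨neg_one_lt_zero.trans_le (norm_nonneg _), hlt⟩]

theorem exists_discShift_mul_tanh_eq (ha : a ∈ ball (0 : ℂ) 1) (hb : b ∈ ball (0 : ℂ) 1) :
    ∃ u : ℂ, ‖u‖ = 1 ∧ discShift a (u * Real.tanh (poincareDist a b)) = b := by
  obtain ⟨u, hu, hpolar⟩ := RCLike.exists_norm_mul_eq_self (discShift (-a) b)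
  refine ⟨u, hu, ?_⟩
  rw [tanh_poincareDist ha hb]
  exact (congrArg (discShift a) hpolar).trans (discShift_discShift_neg ha hb)

end Disc

section Interval

variable {a b c : ℝ}

theorem increment_le_mul_union {D : ℝ → ℝ → ℝ≥0∞} {K : ℝ≥0∞}
    (triangle : ∀ r s t, D r t ≤ D r s + D s t)
    (left : ∀ ⦃s t⦄, a ≤ s → s ≤ t → t ≤ b → D s t ≤ K * ENNReal.ofReal (t - s))
    (right : ∀ ⦃s t⦄, b ≤ s → s ≤ t → t ≤ c → D s t ≤ K * ENNReal.ofReal (t - s)) :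
    ∀ ⦃s t⦄, a ≤ s → s ≤ t → t ≤ c → D s t ≤ K * ENNReal.ofReal (t - s) := by
  intro s t has hst htc
  rcases le_total t b with htb | hbt
  · exact left has hst htb
  rcases le_total b s with hbs | hsb
  · exact right hbs hst htc
  calc D s t ≤ D s b + D b t := triangle s b t
    _ ≤ K * ENNReal.ofReal (b - s) + K * ENNReal.ofReal (t - b) :=
        add_le_add (left has hsb le_rfl) (right le_rfl hbt htc)
    _ = K * ENNReal.ofReal (t - s) := by
        rw [← mul_add, ← ENNReal.ofReal_add (sub_nonneg.2 hsb) (sub_nonneg.2 hbt)]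
        congr 2
        ring

variable {E : Type*} [PseudoEMetricSpace E] {f : ℝ → E} {K : ℝ≥0}

theorem lipschitzOnWith_Icc_iff : LipschitzOnWith K f (Icc a b) ↔
    ∀ ⦃s t⦄, a ≤ s → s ≤ t → t ≤ b → edist (f s) (f t) ≤ K * ENNReal.ofReal (t - s) := by
  have edist_eq : ∀ {s t : ℝ}, s ≤ t → edist s t = ENNReal.ofReal (t - s) := fun hst => by
    rw [edist_comm, edist_dist, Real.dist_eq, abs_of_nonneg (sub_nonneg.2 hst)]
  constructor
  · intro hf s t has hst htb
    rw [← edist_eq hst]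
    exact hf ⟨has, hst.trans htb⟩ ⟨has.trans hst, htb⟩
  · intro hf s hs t ht
    rcases le_total s t with hst | hts
    · rw [edist_eq hst]
      exact hf hs.1 hst ht.2
    · rw [edist_comm, edist_comm s, edist_eq hts]
      exact hf ht.1 hts hs.2

theorem lipschitzOnWith_Icc_union (hab : LipschitzOnWith K f (Icc a b))
    (hbc : LipschitzOnWith K f (Icc b c)) : LipschitzOnWith K f (Icc a c) := by
  rw [lipschitzOnWith_Icc_iff] at *
  exact increment_le_mul_union (fun _ _ _ => edist_triangle _ _ _) hab hbc

end Interval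

section Kobayashi

variable {d : ℕ} {M : Set (CSpace d)} {x y z w : CSpace d}

namespace IsHolomorphicDisc

variable {f : ℂ → CSpace d}

theorem const (hx : x ∈ M) : IsHolomorphicDisc M fun _ => x :=
  ⟨differentiableOn_const _, fun _ _ => hx⟩

theorem comp (hf : IsHolomorphicDisc M f) {φ : ℂ → ℂ} (hφ : DifferentiableOn ℂ φ (ball 0 1))
    (hmaps : MapsTo φ (ball 0 1) (ball 0 1)) : IsHolomorphicDisc M (f ∘ φ) :=
  ⟨hf.1.comp hφ hmaps, hf.2.comp hmaps⟩

theorem comp_discShift (hf : IsHolomorphicDisc M f) {a : ℂ} (ha : a ∈ ball (0 : ℂ) 1) :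
    IsHolomorphicDisc M (f ∘ discShift a) :=
  hf.comp (differentiableOn_discShift ha) (mapsTo_discShift ha)

theorem comp_mul_left (hf : IsHolomorphicDisc M f) {u : ℂ} (hu : ‖u‖ = 1) :
    IsHolomorphicDisc M fun ζ => f (u * ζ) :=
  hf.comp (φ := fun ζ => u * ζ) (by fun_prop) fun ζ hζ => by simpa [hu] using hζ

theorem hasDerivAt (hf : IsHolomorphicDisc M f) {a : ℂ} (ha : a ∈ ball (0 : ℂ) 1) :
    HasDerivAt f (deriv f a) a :=
  (hf.1.differentiableAt (isOpen_ball.mem_nhds ha)).hasDerivAt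

theorem kobayashiMetric_le_one (hf : IsHolomorphicDisc M f) {a : ℂ} (ha : a ∈ ball (0 : ℂ) 1) :
    kobayashiMetric M (f a) ((1 - ‖a‖ ^ 2) • deriv f a) ≤ 1 := by
  have hderiv : HasDerivAt (f ∘ discShift a) (((1 - ‖a‖ ^ 2 : ℝ) : ℂ) • deriv f a) 0 :=
    (hf.hasDerivAt ha).scomp_of_eq 0 (hasDerivAt_discShift_zero a) (discShift_zero a).symm
  refine sInf_le ⟨1, one_pos, rfl, f ∘ discShift a, hf.comp_discShift ha, ?_, ?_⟩
  · rw [Function.comp_apply, discShift_zero]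
  · rw [hderiv.deriv, NNReal.coe_one, one_smul, Complex.coe_smul]

end IsHolomorphicDisc

theorem kobayashiMetric_zero (hx : x ∈ M) : kobayashiMetric M x 0 = 0 := by
  refine le_antisymm (ENNReal.le_of_forall_pos_le_add fun ε hε _ => ?_) zero_le
  rw [zero_add]
  exact sInf_le ⟨ε, hε, rfl, fun _ => x, .const hx, rfl, by simp⟩

namespace DiscChain

/-- The chain consisting of a single disc. -/
def single {f : ℂ → CSpace d} (hf : IsHolomorphicDisc M f) {a b : ℂ}
    (ha : a ∈ ball (0 : ℂ) 1) (hb : b ∈ ball (0 : ℂ) 1) : DiscChain M (f a) (f b) where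
  m := 1
  m_pos := one_pos
  p i := if i = 0 then f a else f b
  f _ := f
  a _ := a
  b _ := b
  p_zero := by simp
  p_last := by simp
  holo _ _ := hf
  a_mem _ _ := ha
  b_mem _ _ := hb
  f_a i hi := by simp [Nat.lt_one_iff.1 hi]
  f_b _ _ := by simp

/-- The chain traversed backwards. -/
def reverse (c : DiscChain M x y) : DiscChain M y x where
  m := c.m
  m_pos := c.m_pos
  p i := c.p (c.m - i)
  f i := c.f (c.m - 1 - i)
  a i := c.b (c.m - 1 - i)
  b i := c.a (c.m - 1 - i)
  p_zero := by simpa using c.p_last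
  p_last := by simpa using c.p_zero
  holo i hi := c.holo _ (by omega)
  a_mem i hi := c.b_mem _ (by omega)
  b_mem i hi := c.a_mem _ (by omega)
  f_a i hi := by
    rw [c.f_b _ (by omega)]
    congr 1
    omega
  f_b i hi := by
    rw [c.f_a _ (by omega)]
    congr 1
    omega

/-- The concatenation of two chains. -/
def append (c : DiscChain M x y) (c' : DiscChain M y z) : DiscChain M x z where
  m := c.m + c'.m
  m_pos := Nat.add_pos_left c.m_pos _
  p i := if i < c.m then c.p i else c'.p (i - c.m)
  f i := if i < c.m then c.f i else c'.f (i - c.m)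
  a i := if i < c.m then c.a i else c'.a (i - c.m)
  b i := if i < c.m then c.b i else c'.b (i - c.m)
  p_zero := by simp [c.m_pos, c.p_zero]
  p_last := by simp [c'.p_last]
  holo i hi := by
    split_ifs with h
    · exact c.holo i h
    · exact c'.holo _ (by omega)
  a_mem i hi := by
    split_ifs with h
    · exact c.a_mem i h
    · exact c'.a_mem _ (by omega)
  b_mem i hi := by
    split_ifs with h
    · exact c.b_mem i h
    · exact c'.b_mem _ (by omega)
  f_a i hi := by
    split_ifs with h
    · exact c.f_a i h
    · exact c'.f_a _ (by omega)
  f_b i hi := by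
    rcases lt_trichotomy (i + 1) c.m with h | h | h
    · simpa [h, (Nat.lt_succ_self i).trans h] using c.f_b i (by omega)
    · have hi' : i < c.m := by omega
      simp [hi', h, c.f_b i hi', c.p_last, c'.p_zero]
    · rw [if_neg (by omega), if_neg (by omega), if_neg (by omega), c'.f_b _ (by omega)]
      congr 1
      omega

theorem length_single {f : ℂ → CSpace d} (hf : IsHolomorphicDisc M f) {a b : ℂ}
    (ha : a ∈ ball (0 : ℂ) 1) (hb : b ∈ ball (0 : ℂ) 1) :
    (single hf ha hb).length = poincareDist a b := by
  simp [length, single]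

theorem length_reverse (c : DiscChain M x y) : c.reverse.length = c.length := by
  unfold length reverse
  rw [← Finset.sum_range_reflect (fun i => poincareDist (c.a i) (c.b i))]
  exact Finset.sum_congr rfl fun i _ => poincareDist_comm _ _

theorem length_append (c : DiscChain M x y) (c' : DiscChain M y z) :
    (c.append c').length = c.length + c'.length := by
  unfold length
  change ∑ i ∈ Finset.range (c.m + c'.m), _ = _
  rw [Finset.sum_range_add]
  congr 1
  · refine Finset.sum_congr rfl fun i hi => ?_
    simp [append, Finset.mem_range.1 hi]
  · refine Finset.sum_congr rfl fun i _ => ?_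
    simp [append]

theorem length_nonneg (c : DiscChain M x y) : 0 ≤ c.length :=
  Finset.sum_nonneg fun _ _ => poincareDist_nonneg _ _

theorem left_mem (c : DiscChain M x y) : x ∈ M := by
  rw [← c.p_zero, ← c.f_a 0 c.m_pos]
  exact (c.holo 0 c.m_pos).2 (c.a_mem 0 c.m_pos)

end DiscChain

theorem kobayashiDist_comm (x y : CSpace d) : kobayashiDist M x y = kobayashiDist M y x := by
  have le_swap : ∀ x y : CSpace d, kobayashiDist M x y ≤ kobayashiDist M y x := fun x y =>
    le_iInf fun c => (iInf_le _ c.reverse).trans_eq (by rw [c.length_reverse])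
  exact le_antisymm (le_swap x y) (le_swap y x)

theorem kobayashiDist_triangle (x y z : CSpace d) :
    kobayashiDist M x z ≤ kobayashiDist M x y + kobayashiDist M y z :=
  ENNReal.le_iInf_add_iInf fun c c' => (iInf_le _ (c.append c')).trans_eq <| by
    rw [c.length_append, ENNReal.ofReal_add c.length_nonneg c'.length_nonneg]

theorem IsHolomorphicDisc.kobayashiDist_le {f : ℂ → CSpace d} (hf : IsHolomorphicDisc M f)
    {a b : ℂ} (ha : a ∈ ball (0 : ℂ) 1) (hb : b ∈ ball (0 : ℂ) 1) :
    kobayashiDist M (f a) (f b) ≤ ENNReal.ofReal (poincareDist a b) :=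
  (iInf_le _ (DiscChain.single hf ha hb)).trans_eq (by rw [DiscChain.length_single])

theorem kobayashiDist_self (hx : x ∈ M) : kobayashiDist M x x = 0 := by
  simpa [poincareDist] using (IsHolomorphicDisc.const hx).kobayashiDist_le
    (mem_ball_self one_pos) (mem_ball_self one_pos)

/-- `σ : [a, b] → M` is a sub-unit curve: it is Lipschitz, its Kobayashi speed is at most `1` almost
everywhere, and it does not increase distances. The last condition is required separately because
deducing it from the bound on the speed would take Royden's theorem that `kobayashiDist` is the
integrated form of `kobayashiMetric`. -/
structure IsSubunitCurve (M : Set (CSpace d)) (a b : ℝ) (σ : ℝ → CSpace d) : Prop where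
  mapsTo : MapsTo σ (Icc a b) M
  exists_lipschitzOnWith : ∃ K, LipschitzOnWith K σ (Icc a b)
  kobayashiDist_le : ∀ ⦃s t⦄, a ≤ s → s ≤ t → t ≤ b →
    kobayashiDist M (σ s) (σ t) ≤ ENNReal.ofReal (t - s)
  speed_le : ∀ᵐ t ∂volume.restrict (Icc a b),
    DifferentiableAt ℝ σ t ∧ kobayashiMetric M (σ t) (deriv σ t) ≤ 1

namespace IsSubunitCurve

variable {a b c κ : ℝ} {σ τ : ℝ → CSpace d}

theorem const (hx : x ∈ M) (a b : ℝ) : IsSubunitCurve M a b fun _ => x where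
  mapsTo _ _ := hx
  exists_lipschitzOnWith := ⟨0, (LipschitzWith.const x).lipschitzOnWith⟩
  kobayashiDist_le _ _ _ _ _ := by simp [kobayashiDist_self hx]
  speed_le := .of_forall fun t => ⟨differentiableAt_const _, by simp [kobayashiMetric_zero hx]⟩

theorem congr (hσ : IsSubunitCurve M a b σ) (h : EqOn τ σ (Icc a b)) :
    IsSubunitCurve M a b τ where
  mapsTo := hσ.mapsTo.congr h.symm
  exists_lipschitzOnWith := hσ.exists_lipschitzOnWith.imp fun _ hK s hs t ht => by
    rw [h hs, h ht]
    exact hK hs ht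
  kobayashiDist_le s t has hst htb := by
    rw [h ⟨has, hst.trans htb⟩, h ⟨has.trans hst, htb⟩]
    exact hσ.kobayashiDist_le has hst htb
  speed_le := by
    have hspeed := hσ.speed_le
    rw [← restrict_Ioo_eq_restrict_Icc] at hspeed ⊢
    filter_upwards [hspeed, ae_restrict_mem measurableSet_Ioo] with t ⟨hdiff, hle⟩ ht
    have hev : τ =ᶠ[𝓝 t] σ := h.eventuallyEq_of_mem (Icc_mem_nhds ht.1 ht.2)
    exact ⟨hdiff.congr_of_eventuallyEq hev, by rwa [hev.deriv_eq, hev.eq_of_nhds]⟩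

theorem comp_sub_const (hσ : IsSubunitCurve M a b σ) (c : ℝ) :
    IsSubunitCurve M (a + c) (b + c) fun t => σ (t - c) := by
  have hmaps : MapsTo (fun t => t - c) (Icc (a + c) (b + c)) (Icc a b) :=
    (preimage_sub_const_Icc c a b).superset
  refine ⟨hσ.mapsTo.comp hmaps, ?_, fun s t has hst htb => ?_, ?_⟩
  · obtain ⟨K, hK⟩ := hσ.exists_lipschitzOnWith
    refine ⟨K, fun s hs t ht => ?_⟩
    simpa only [edist_sub_right] using hK (hmaps hs) (hmaps ht)
  · simpa only [sub_sub_sub_cancel_right] using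
      hσ.kobayashiDist_le (le_sub_iff_add_le.2 has) (sub_le_sub_right hst c)
        (sub_le_iff_le_add.2 htb)
  · have hshift := (measurePreserving_sub_right volume c).restrict_preimage
      (measurableSet_Icc (a := a) (b := b))
    rw [preimage_sub_const_Icc] at hshift
    filter_upwards [hshift.quasiMeasurePreserving.ae hσ.speed_le] with t ⟨hdiff, hle⟩
    rw [deriv_comp_sub_const]
    exact ⟨differentiableAt_comp_sub_const.2 hdiff, hle⟩

theorem union (hσab : IsSubunitCurve M a b σ) (hσbc : IsSubunitCurve M b c σ) (hab : a ≤ b)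
    (hbc : b ≤ c) : IsSubunitCurve M a c σ where
  mapsTo := by
    rw [← Icc_union_Icc_eq_Icc hab hbc]
    exact hσab.mapsTo.union hσbc.mapsTo
  exists_lipschitzOnWith := by
    obtain ⟨K, hK⟩ := hσab.exists_lipschitzOnWith
    obtain ⟨K', hK'⟩ := hσbc.exists_lipschitzOnWith
    exact ⟨max K K', lipschitzOnWith_Icc_union (hK.weaken (le_max_left _ _))
      (hK'.weaken (le_max_right _ _))⟩
  kobayashiDist_le := by
    simpa only [one_mul] using increment_le_mul_union (K := 1)
      (D := fun s t => kobayashiDist M (σ s) (σ t)) (fun _ _ _ => kobayashiDist_triangle _ _ _)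
      (by simpa only [one_mul] using hσab.kobayashiDist_le)
      (by simpa only [one_mul] using hσbc.kobayashiDist_le)
  speed_le := by
    rw [← Icc_union_Icc_eq_Icc hab hbc, ae_restrict_union_iff]
    exact ⟨hσab.speed_le, hσbc.speed_le⟩

theorem ofReal_sub_le_kobayashiDist_add (hσ : IsSubunitCurve M a b σ)
    (hmin : ENNReal.ofReal (b - a) ≤ kobayashiDist M (σ a) (σ b) + ENNReal.ofReal κ) {s t : ℝ}
    (has : a ≤ s) (hst : s ≤ t) (htb : t ≤ b) :
    ENNReal.ofReal (t - s) ≤ kobayashiDist M (σ s) (σ t) + ENNReal.ofReal κ := by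
  have hsa : 0 ≤ s - a := sub_nonneg.2 has
  have hbt : 0 ≤ b - t := sub_nonneg.2 htb
  set r := ENNReal.ofReal (s - a) + ENNReal.ofReal (b - t) with hr
  have hr_top : r ≠ ⊤ := ENNReal.add_ne_top.2 ⟨ENNReal.ofReal_ne_top, ENNReal.ofReal_ne_top⟩
  refine ENNReal.le_of_add_le_add_left hr_top ?_
  calc r + ENNReal.ofReal (t - s) = ENNReal.ofReal (b - a) := by
        rw [hr, ← ENNReal.ofReal_add hsa hbt,
          ← ENNReal.ofReal_add (add_nonneg hsa hbt) (sub_nonneg.2 hst)]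
        congr 1
        ring
    _ ≤ kobayashiDist M (σ a) (σ b) + ENNReal.ofReal κ := hmin
    _ ≤ kobayashiDist M (σ a) (σ s) + (kobayashiDist M (σ s) (σ t) + kobayashiDist M (σ t) (σ b)) +
          ENNReal.ofReal κ := by
        gcongr
        exact (kobayashiDist_triangle _ (σ s) _).trans <| by gcongr; exact kobayashiDist_triangle ..
    _ ≤ ENNReal.ofReal (s - a) + (kobayashiDist M (σ s) (σ t) + ENNReal.ofReal (b - t)) +
          ENNReal.ofReal κ := by
        gcongr
        · exact hσ.kobayashiDist_le le_rfl has (hst.trans htb)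
        · exact hσ.kobayashiDist_le (has.trans hst) htb le_rfl
    _ = r + (kobayashiDist M (σ s) (σ t) + ENNReal.ofReal κ) := by rw [hr]; ring

theorem isAlmostGeodesic (hσ : IsSubunitCurve M a b σ) (hab : a ≤ b) (hκ : 0 ≤ κ)
    (hmin : ENNReal.ofReal (b - a) ≤ kobayashiDist M (σ a) (σ b) + ENNReal.ofReal κ) :
    IsAlmostGeodesic M 1 κ a b σ := by
  have bounds : ∀ ⦃s t⦄, a ≤ s → s ≤ t → t ≤ b →
      ENNReal.ofReal (t - s - κ) ≤ kobayashiDist M (σ s) (σ t) ∧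
        kobayashiDist M (σ s) (σ t) ≤ ENNReal.ofReal (t - s + κ) := fun s t has hst htb => by
    constructor
    · rw [ENNReal.ofReal_sub _ hκ, tsub_le_iff_right]
      exact hσ.ofReal_sub_le_kobayashiDist_add hmin has hst htb
    · exact (hσ.kobayashiDist_le has hst htb).trans
        (ENNReal.ofReal_le_ofReal (le_add_of_nonneg_right hκ))
  have bounds_abs : ∀ s ∈ Icc a b, ∀ t ∈ Icc a b,
      ENNReal.ofReal (|t - s| - κ) ≤ kobayashiDist M (σ t) (σ s) ∧
        kobayashiDist M (σ t) (σ s) ≤ ENNReal.ofReal (|t - s| + κ) := fun s hs t ht => by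
    rcases le_total s t with hst | hts
    · rw [kobayashiDist_comm, abs_of_nonneg (sub_nonneg.2 hst)]
      exact bounds hs.1 hst ht.2
    · rw [abs_sub_comm, abs_of_nonneg (sub_nonneg.2 hts)]
      exact bounds ht.1 hts hs.2
  obtain ⟨K, hK⟩ := hσ.exists_lipschitzOnWith
  rw [← uIcc_of_le hab] at hK
  exact
    { mapsTo := hσ.mapsTo
      lower := by simpa using fun s hs t ht => (bounds_abs s hs t ht).1
      upper := by simpa using fun s hs t ht => (bounds_abs s hs t ht).2
      absCont := hK.absolutelyContinuousOnInterval
      speed := by simpa using hσ.speed_le }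

end IsSubunitCurve

theorem IsHolomorphicDisc.isSubunitCurve_tanh {f : ℂ → CSpace d} (hf : IsHolomorphicDisc M f)
    (a b : ℝ) : IsSubunitCurve M a b fun t => f (Real.tanh t) where
  mapsTo t _ := hf.2 (ofReal_tanh_mem_ball t)
  exists_lipschitzOnWith := by
    have hf' : ContDiffOn ℝ 1 f (ball 0 1) :=
      (hf.1.contDiffOn isOpen_ball).restrict_scalars ℝ
    have htanh : ContDiff ℝ 1 fun t : ℝ => (Real.tanh t : ℂ) :=
      Complex.ofRealCLM.contDiff.comp contDiff_real_tanh
    exact (hf'.comp htanh.contDiffOn fun t _ => ofReal_tanh_mem_ball t).exists_lipschitzOnWith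
      one_ne_zero (convex_Icc a b) isCompact_Icc
  kobayashiDist_le s t _ hst _ := by
    refine (hf.kobayashiDist_le (ofReal_tanh_mem_ball s) (ofReal_tanh_mem_ball t)).trans_eq ?_
    rw [poincareDist_tanh, abs_sub_comm, abs_of_nonneg (sub_nonneg.2 hst)]
  speed_le := .of_forall fun t => by
    have hderiv : HasDerivAt (fun t : ℝ => f (Real.tanh t))
        (((1 - Real.tanh t ^ 2 : ℝ) : ℂ) • deriv f (Real.tanh t)) t :=
      (hf.hasDerivAt (ofReal_tanh_mem_ball t)).scomp t (hasDerivAt_real_tanh t).ofReal_comp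
    refine ⟨hderiv.differentiableAt, ?_⟩
    rw [hderiv.deriv, Complex.coe_smul]
    simpa only [Complex.norm_real, Real.norm_eq_abs, sq_abs] using
      hf.kobayashiMetric_le_one (ofReal_tanh_mem_ball t)

/-- The points `x` and `y` are joined in `M` by a sub-unit curve of duration `L`. -/
def SubunitJoined (M : Set (CSpace d)) (L : ℝ) (x y : CSpace d) : Prop :=
  0 ≤ L ∧ ∃ σ, IsSubunitCurve M 0 L σ ∧ σ 0 = x ∧ σ L = y

theorem SubunitJoined.refl (hx : x ∈ M) {L : ℝ} (hL : 0 ≤ L) : SubunitJoined M L x x :=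
  ⟨hL, fun _ => x, .const hx 0 L, rfl, rfl⟩

theorem SubunitJoined.trans {L L' : ℝ} (hxy : SubunitJoined M L x y)
    (hyz : SubunitJoined M L' y z) : SubunitJoined M (L + L') x z := by
  obtain ⟨hL, σ, hσ, rfl, rfl⟩ := hxy
  obtain ⟨hL', τ, hτ, hτσ, rfl⟩ := hyz
  set γ : ℝ → CSpace d := fun t => if t ≤ L then σ t else τ (t - L)
  have hγσ : EqOn γ σ (Icc 0 L) := fun t ht => if_pos ht.2
  have hγτ : EqOn γ (fun t => τ (t - L)) (Icc L (L' + L)) := fun t ht => by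
    rcases ht.1.eq_or_lt with rfl | hlt
    · simp [γ, hτσ]
    · exact if_neg hlt.not_ge
  have hτ' : IsSubunitCurve M L (L' + L) fun t => τ (t - L) := by
    simpa only [zero_add] using hτ.comp_sub_const L
  have hLL' : L ≤ L' + L := le_add_of_nonneg_left hL'
  rw [add_comm L L']
  refine ⟨add_nonneg hL' hL, γ, (hσ.congr hγσ).union (hτ'.congr hγτ) hL hLL', ?_, ?_⟩
  · exact hγσ ⟨le_rfl, hL⟩
  · simpa using hγτ ⟨hLL', le_rfl⟩

theorem IsHolomorphicDisc.subunitJoined {f : ℂ → CSpace d} (hf : IsHolomorphicDisc M f)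
    {a b : ℂ} (ha : a ∈ ball (0 : ℂ) 1) (hb : b ∈ ball (0 : ℂ) 1) :
    SubunitJoined M (poincareDist a b) (f a) (f b) := by
  obtain ⟨u, hu, hub⟩ := exists_discShift_mul_tanh_eq ha hb
  refine ⟨poincareDist_nonneg a b, _,
    ((hf.comp_discShift ha).comp_mul_left hu).isSubunitCurve_tanh _ _, ?_, ?_⟩
  · simp [discShift_zero]
  · simp only [Function.comp_apply, hub]

theorem DiscChain.subunitJoined (c : DiscChain M x y) : SubunitJoined M c.length x y := by
  have joined_to_node : ∀ k ≤ c.m,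
      SubunitJoined M (∑ i ∈ Finset.range k, poincareDist (c.a i) (c.b i)) x (c.p k) := by
    intro k
    induction k with
    | zero =>
      intro _
      rw [c.p_zero, Finset.sum_range_zero]
      exact .refl c.left_mem le_rfl
    | succ k ih =>
      intro hk
      have hlink := (c.holo k hk).subunitJoined (c.a_mem k hk) (c.b_mem k hk)
      rw [c.f_a k hk, c.f_b k hk] at hlink
      rw [Finset.sum_range_succ]
      exact (ih (Nat.le_of_succ_le hk)).trans hlink
  simpa only [length, c.p_last] using joined_to_node c.m le_rfl

theorem subunitJoined_of_kobayashiDist_lt {L : ℝ} (h : kobayashiDist M x y < ENNReal.ofReal L) :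
    SubunitJoined M L x y := by
  obtain ⟨c, hc⟩ := iInf_lt_iff.1 h
  have hcL : 0 ≤ L - c.length :=
    sub_nonneg.2 (ENNReal.ofReal_lt_ofReal_iff_of_nonneg c.length_nonneg |>.1 hc).le
  -- The curve waits at `x` for the spare time.
  simpa only [sub_add_cancel] using (SubunitJoined.refl c.left_mem hcL).trans c.subunitJoined

theorem exists_isAlmostGeodesic_of_kobayashiDist_ne_top (h : kobayashiDist M z w ≠ ⊤) {κ : ℝ}
    (hκ : 0 < κ) : ∃ (a b : ℝ) (σ : ℝ → CSpace d),
      a < b ∧ IsAlmostGeodesic M 1 κ a b σ ∧ σ a = z ∧ σ b = w := by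
  set L := (kobayashiDist M z w).toReal + κ
  have hL : ENNReal.ofReal L = kobayashiDist M z w + ENNReal.ofReal κ := by
    rw [ENNReal.ofReal_add ENNReal.toReal_nonneg hκ.le, ENNReal.ofReal_toReal h]
  have hL_pos : 0 < L := add_pos_of_nonneg_of_pos ENNReal.toReal_nonneg hκ
  have hlt : kobayashiDist M z w < ENNReal.ofReal L := by
    rw [hL]
    exact ENNReal.lt_add_right h (ENNReal.ofReal_pos.2 hκ).ne'
  obtain ⟨-, σ, hσ, hσz, hσw⟩ := subunitJoined_of_kobayashiDist_lt hlt
  have hmin : ENNReal.ofReal (L - 0) ≤ kobayashiDist M (σ 0) (σ L) + ENNReal.ofReal κ := by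
    rw [sub_zero, hL, hσz, hσw]
  exact ⟨0, L, σ, hL_pos, hσ.isAlmostGeodesic hL_pos.le hκ.le hmin, hσz, hσw⟩

theorem eventually_forall_lineMap_mem {E : Type*} [NormedAddCommGroup E] [NormedSpace ℂ E] {p : E}
    {U : Set E} (hU : U ∈ 𝓝 p) :
    ∀ᶠ q in 𝓝 p, ∀ ζ ∈ ball (0 : ℂ) 1, AffineMap.lineMap p q (2 * ζ) ∈ U := by
  obtain ⟨r, hr, hrU⟩ := Metric.mem_nhds_iff.1 hU
  filter_upwards [ball_mem_nhds p (half_pos hr)] with q hq ζ hζ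
  apply hrU
  rw [mem_ball_zero_iff] at hζ
  rw [mem_ball, dist_comm] at hq
  rw [mem_ball, dist_lineMap_left, norm_mul, Complex.norm_ofNat]
  nlinarith [norm_nonneg ζ, dist_nonneg (x := p) (y := q)]

namespace IsEmbeddedComplexSubmanifold

variable {n : ℕ}

theorem eventually_exists_isHolomorphicDisc (hM : IsEmbeddedComplexSubmanifold n M) (hx : x ∈ M) :
    ∀ᶠ y in 𝓝[M] x, ∃ f, IsHolomorphicDisc M f ∧ f 0 = x ∧ f (1 / 2) = y := by
  obtain ⟨Φ, V, hxΦ, -, hΦsymm, -, hslice⟩ := hM x hx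
  have hΦV : ∀ q ∈ Φ.source, q ∈ M → Φ q ∈ V := fun q hq hqM =>
    (hslice.subset ⟨q, ⟨hq, hqM⟩, rfl⟩).2
  have hVM : ∀ v ∈ Φ.target, v ∈ V → Φ.symm v ∈ M := fun v hv hvV => by
    obtain ⟨q, ⟨hq, hqM⟩, rfl⟩ := hslice.superset ⟨hv, hvV⟩
    rwa [Φ.left_inv hq]
  have hline : ∀ᶠ y in 𝓝 x, ∀ ζ ∈ ball (0 : ℂ) 1,
      AffineMap.lineMap (Φ x) (Φ y) (2 * ζ) ∈ Φ.target :=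
    (Φ.continuousAt hxΦ).eventually <|
      eventually_forall_lineMap_mem (Φ.open_target.mem_nhds (Φ.map_source hxΦ))
  filter_upwards [nhdsWithin_le_nhds hline,
    nhdsWithin_le_nhds (Φ.open_source.mem_nhds hxΦ), self_mem_nhdsWithin] with y hy hyΦ hyM
  refine ⟨fun ζ => Φ.symm (AffineMap.lineMap (Φ x) (Φ y) (2 * ζ)), ⟨?_, fun ζ hζ => ?_⟩, ?_, ?_⟩
  · refine hΦsymm.comp ?_ hy
    simp only [AffineMap.lineMap_apply_module']
    fun_prop
  · exact hVM _ (hy ζ hζ) <| AffineMap.lineMap_mem (Q := V.toAffineSubspace) (2 * ζ)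
      (hΦV x hxΦ hx) (hΦV y hyΦ hyM)
  · simp [Φ.left_inv hxΦ]
  · simp [Φ.left_inv hyΦ]

theorem kobayashiDist_ne_top (hM : IsEmbeddedComplexSubmanifold n M) (hconn : IsPreconnected M)
    (hx : x ∈ M) (hy : y ∈ M) : kobayashiDist M x y ≠ ⊤ := by
  refine hconn.induction₂ (fun x y => kobayashiDist M x y ≠ ⊤) (fun x hx => ?_) ?_ ?_ hx hy
  · filter_upwards [hM.eventually_exists_isHolomorphicDisc hx] with y ⟨f, hf, hfx, hfy⟩
    rw [← hfx, ← hfy]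
    exact ne_top_of_le_ne_top ENNReal.ofReal_ne_top
      (hf.kobayashiDist_le (by simp) (by norm_num))
  · exact fun x y z _ _ _ hxy hyz =>
      ne_top_of_le_ne_top (ENNReal.add_ne_top.2 ⟨hxy, hyz⟩) (kobayashiDist_triangle x y z)
  · exact fun x y _ _ hxy => by rwa [kobayashiDist_comm]

end IsEmbeddedComplexSubmanifold

end Kobayashi

theorem mainTheorem7_general {d n : ℕ} (M : Set (CSpace d))
    (hM : IsEmbeddedComplexSubmanifold n M) (hconn : IsPreconnected M)
    (z w : CSpace d) (hz : z ∈ M) (hw : w ∈ M) (κ : ℝ) (hκ : 0 < κ) :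
    ∃ (a b : ℝ) (σ : ℝ → CSpace d),
      a < b ∧ IsAlmostGeodesic M 1 κ a b σ ∧ σ a = z ∧ σ b = w :=
  exists_isAlmostGeodesic_of_kobayashiDist_ne_top (hM.kobayashiDist_ne_top hconn hz hw) hκ

theorem mainTheorem7 {d n : ℕ} (M : Set (CSpace d))
    (hM : IsEmbeddedComplexSubmanifold n M)
    (hconn : IsConnected M) (hbdd : Bornology.IsBounded M)
    (z w : CSpace d) (hz : z ∈ M) (hw : w ∈ M) (κ : ℝ) (hκ : 0 < κ) :
    ∃ (a b : ℝ) (σ : ℝ → CSpace d),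
      a < b ∧ IsAlmostGeodesic M 1 κ a b σ ∧ σ a = z ∧ σ b = w :=
  mainTheorem7_general M hM hconn.isPreconnected z w hz hw κ hκ
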